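/- Let $\triangle$ be the open unit disk in $\mathbb C$. For a complex manifold $X$ and $(x,v)\in TX$ set $$\omega^X_K(x,v):=\inf\Big\{\tfrac1\lambda:\ \lambda>0,\ f:\triangle\to X \text{ holomorphic},\ f(0)=x,\ df(0)(1)=\lambda v\Big\},$$ $$\omega^X_\iota(x,v):=\inf\Big\{\tfrac1\lambda:\ \lambda>0,\ f:\triangle\to X \text{ holomorphic and injective},\ f(0)=x,\ df(0)(1)=\lambda v\Big\}$$ (with values in $[0,\infty]$, $\inf\emptyset=\infty$), the Kobayashi metric and the injective Kobayashi metric of $X$. A holomorphic automorphism $\varphi$ of $\triangle$ is called hyperbolic if it has precisely two distinct fixed points in $\overline\triangle$ (where $\varphi$ is extended continuously to $\overline\triangle$), and both lie on the boundary $b\triangle$. A Riemann surface $Y$ is called an annulus if it is biholomorphic to $\triangle/\langle\varphi\rangle$ for some hyperbolic automorphism $\varphi$ of $\triangle$. **Theorem.** Let $Y_1$ and $Y_2$ be annuli, and set $X:=Y_1\times Y_2$. Then $\omega^X_\iota\neq\omega^X_K$, i.e. the two metrics do not coincide as functions on $TX$. -/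

import Mathlib

open scoped Manifold ContDiff ENNReal Complex.UnitDisc

noncomputable section

/-- The inclusion of the unit disc `𝔻` into `ℂ` is an open embedding. -/
theorem unitDisc_isOpenEmbedding_coe : Topology.IsOpenEmbedding ((↑) : 𝔻 → ℂ) :=
  (Metric.isOpen_ball (x := (0 : ℂ)) (ε := 1)).isOpenEmbedding_subtypeVal

/-- The unit disc as a Riemann surface: its only chart is the inclusion into `ℂ`. -/
instance unitDiscChartedSpace : ChartedSpace ℂ 𝔻 :=
  unitDisc_isOpenEmbedding_coe.singletonChartedSpace

instance unitDiscIsManifold : IsManifold 𝓘(ℂ) ω 𝔻 :=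
  unitDisc_isOpenEmbedding_coe.isManifold_singleton

section Metrics

variable {E : Type*} [NormedAddCommGroup E] [NormedSpace ℂ E]
  {H : Type*} [TopologicalSpace H] (I : ModelWithCorners ℂ E H)
  (X : Type*) [TopologicalSpace X] [ChartedSpace H X]

/-- The (infinitesimal) Kobayashi metric of the complex manifold `X`: its value at `(x, v) ∈ TX` is
the infimum of `1 / r` over all `r > 0` and all holomorphic `f : 𝔻 → X` with `f(0) = x` and
`df(0)(1) = r v`. The infimum is taken in `[0, ∞]`, so that it is `∞` over the empty set. -/
def kobayashiMetric (p : TangentBundle I X) : ℝ≥0∞ :=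
  ⨅ (f : 𝔻 → X) (r : ℝ) (_ : 0 < r) (_ : MDifferentiable 𝓘(ℂ) I f)
    (_ : tangentMap 𝓘(ℂ) I f ⟨0, (1 : ℂ)⟩ = ⟨p.proj, (r : ℂ) • p.2⟩), ENNReal.ofReal (1 / r)

/-- The injective Kobayashi metric (Hahn metric) of the complex manifold `X`: as in
`kobayashiMetric`, but only injective holomorphic maps `f : 𝔻 → X` are allowed. -/
def injectiveKobayashiMetric (p : TangentBundle I X) : ℝ≥0∞ :=
  ⨅ (f : 𝔻 → X) (r : ℝ) (_ : 0 < r) (_ : MDifferentiable 𝓘(ℂ) I f) (_ : Function.Injective f)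
    (_ : tangentMap 𝓘(ℂ) I f ⟨0, (1 : ℂ)⟩ = ⟨p.proj, (r : ℂ) • p.2⟩), ENNReal.ofReal (1 / r)

end Metrics

/-- The group of holomorphic automorphisms of the unit disc. -/
def discAut : Subgroup (Equiv.Perm 𝔻) where
  carrier := {φ | MDifferentiable 𝓘(ℂ) 𝓘(ℂ) φ ∧ MDifferentiable 𝓘(ℂ) 𝓘(ℂ) φ.symm}
  mul_mem' := fun ha hb => ⟨ha.1.comp hb.1, hb.2.comp ha.2⟩
  one_mem' := ⟨mdifferentiable_id, mdifferentiable_id⟩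
  inv_mem' := fun ha => ⟨ha.2, ha.1⟩

/-- A holomorphic automorphism `φ` of the unit disc is hyperbolic if (its continuous extension `Φ`
to the closed disc) has precisely two fixed points in the closed disc, and both of them lie on the
unit circle. -/
def IsHyperbolicDiscAut (φ : Equiv.Perm 𝔻) : Prop :=
  φ ∈ discAut ∧
    ∃ Φ : ℂ → ℂ, ContinuousOn Φ (Metric.closedBall 0 1) ∧ (∀ z : 𝔻, Φ z = φ z) ∧
      ∃ p q : ℂ, p ≠ q ∧ ‖p‖ = 1 ∧ ‖q‖ = 1 ∧ {z ∈ Metric.closedBall (0 : ℂ) 1 | Φ z = z} = {p, q}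

/-- A Riemann surface `Y` is an annulus if it is the quotient `𝔻 / ⟨φ⟩` for some hyperbolic
automorphism `φ` of the unit disc, that is, if there is a surjective local biholomorphism
`π : 𝔻 → Y` whose fibres are precisely the orbits of the cyclic group `⟨φ⟩`. -/
def IsAnnulus (Y : Type*) [TopologicalSpace Y] [ChartedSpace ℂ Y] : Prop :=
  ∃ φ : Equiv.Perm 𝔻, IsHyperbolicDiscAut φ ∧
    ∃ π : 𝔻 → Y, Function.Surjective π ∧ IsLocalDiffeomorph 𝓘(ℂ) 𝓘(ℂ) ω π ∧
      ∀ z w : 𝔻, π z = π w ↔ z ∈ MulAction.orbit (Subgroup.zpowers φ) w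

end

open scoped ComplexConjugate
open Metric Set Filter Topology

/-! Take coverings `Q₁`, `Q₂` of the two annuli by the disc. The disc `f = (Q₁, Q₂)` bounds the
Kobayashi metric at `f'(0)` by 1. If the metrics agreed, there would be injective discs `g` with
`g(0) = f(0)` and `g'(0) = r f'(0)`, with `r` above any prescribed `δ < 1`. Such a `g` lifts to `(Q₁
∘ a₁, Q₂ ∘ a₂)` with `aᵢ(0) = 0` and `aᵢ'(0) = r`, and the Schwarz lemma forces `aᵢ` to be nearly
the identity on compact sets.

Suppose deck transformations `T₁`, `T₂` satisfy `T₁(0) = T₂(0) = s ≠ 0` and `T₁'(0) ≠ T₂'(0)`. Their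
graphs then cross transversally at `(0, s)`, which is a stable self-intersection of `f`: the
perturbed system `a₁(w) = T₁(a₁(z))`, `a₂(w) = T₂(a₂(z))` still has a solution near `(0, s)`
(`exists_solution_of_near_id`). It gives `g(z) = g(w)` with `z ≠ w`, a contradiction.

To find such `Tᵢ`, note that the displacement of a hyperbolic automorphism is continuous and tends
to 1 at a boundary point that is not fixed. Both generators thus attain a common displacement `t`,
and moving the base points turns them into `z ↦ mobius s (u • z)` and `z ↦ mobius s (v • z)` with `s
= t`. The derivatives at 0 differ when `u ≠ v`. If `u = v`, a half-turn replaces `v` by `v⁻¹`, which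
differs from `u` because `u ≠ ±1`. -/

/-! ### A quantitative Schwarz lemma. -/

/-- The quotient `q = a(z)/z` takes values in the closed disc and `q(0) = r`. Schwarz applied to `(q
- r)/(1 - r q)` bounds `q - r`. -/
theorem norm_sub_self_le_of_mapsTo_ball {a : ℂ → ℂ} (ha : DifferentiableOn ℂ a (ball 0 1))
    (hm : MapsTo a (ball 0 1) (ball 0 1)) (h0 : a 0 = 0) {r : ℝ} (hr : 0 ≤ r)
    (hd : deriv a 0 = r) {z : ℂ} (hz : ‖z‖ < 1) :
    r ≤ 1 ∧ ‖a z - z‖ ≤ (1 - r) + (1 - r ^ 2) / (1 - ‖z‖) := by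
  have hz' : z ∈ ball (0 : ℂ) 1 := by simpa using hz
  have hm' : MapsTo a (ball 0 1) (closedBall (a 0) 1) := by
    rw [h0]; exact hm.mono_right ball_subset_closedBall
  have hq : ∀ w ∈ ball (0 : ℂ) 1, ‖dslope a 0 w‖ ≤ 1 := fun w hw ↦ by
    simpa using Complex.norm_dslope_le_div_of_mapsTo_ball ha hm' hw
  have hr1 : r ≤ 1 := by
    have := hq 0 (by simp)
    rwa [dslope_same, hd, Complex.norm_real, Real.norm_of_nonneg hr] at this
  refine ⟨hr1, ?_⟩
  have haz : a z = z * dslope a 0 z := by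
    have := sub_smul_dslope a 0 z
    simpa [h0] using this.symm
  -- For `r = 1` the denominator `1 - r q` vanishes; this is the equality case of Schwarz, where `a`
  -- is the identity.
  rcases hr1.eq_or_lt with h1 | h1
  · have := Complex.affine_of_mapsTo_ball_of_norm_dslope_eq_div (z₀ := 0) ha hm' (by simp)
      (by simp [hd, h1]) hz'
    simp [this, h0, hd, h1]
  have hqd : DifferentiableOn ℂ (dslope a 0) (ball 0 1) :=
    (Complex.differentiableOn_dslope (isOpen_ball.mem_nhds (by simp))).2 ha
  have hne : ∀ w ∈ ball (0 : ℂ) 1, 1 - r * dslope a 0 w ≠ 0 := fun w hw h ↦ by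
    have h2 : ‖(r : ℂ) * dslope a 0 w‖ = 1 := by rw [← sub_eq_zero.1 h]; simp
    rw [norm_mul, Complex.norm_real, Real.norm_of_nonneg hr] at h2
    nlinarith [hq w hw, norm_nonneg (dslope a 0 w)]
  have key := Complex.norm_le_norm_of_mapsTo_ball
    (f := fun w ↦ (dslope a 0 w - r) / (1 - r * dslope a 0 w)) (R := 1) (z := z)
    ((hqd.sub_const _).div ((hqd.const_mul _).const_sub _) hne) (fun w hw ↦ by
      rw [mem_closedBall_zero_iff, norm_div, div_le_one (norm_pos_iff.2 (hne w hw)),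
        ← sq_le_sq₀ (norm_nonneg _) (norm_nonneg _), Complex.sq_norm, Complex.sq_norm]
      have h2 : Complex.normSq (dslope a 0 w) ≤ 1 := by
        rw [← Complex.sq_norm]; exact pow_le_one₀ (norm_nonneg _) (hq w hw)
      simp only [Complex.normSq_apply, Complex.sub_re, Complex.sub_im, Complex.ofReal_re,
        Complex.ofReal_im, Complex.one_re, Complex.one_im, Complex.mul_re, Complex.mul_im] at h2 ⊢
      nlinarith [mul_nonneg (sub_nonneg.2 h2) (sub_nonneg.2 (pow_le_one₀ hr hr1 : r ^ 2 ≤ 1))])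
    (by simp [hd]) hz
  rw [norm_div, div_le_iff₀ (norm_pos_iff.2 (hne z hz'))] at key
  have h3 : ‖1 - r * dslope a 0 z‖ ≤ (1 - r ^ 2) + r * ‖dslope a 0 z - r‖ := by
    have : 1 - r * dslope a 0 z = ((1 - r ^ 2 : ℝ) : ℂ) - (r : ℂ) * (dslope a 0 z - r) := by
      push_cast; ring
    rw [this]
    refine (norm_sub_le _ _).trans_eq ?_
    rw [norm_mul, Complex.norm_real, Complex.norm_real, Real.norm_of_nonneg hr,
      Real.norm_of_nonneg (sub_nonneg.2 (pow_le_one₀ hr hr1))]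
  have h4 : ‖dslope a 0 z - r‖ ≤ (1 - r ^ 2) / (1 - ‖z‖) := by
    rw [le_div_iff₀ (by linarith)]
    have h5 : (0 : ℝ) ≤ 1 - r ^ 2 := sub_nonneg.2 (pow_le_one₀ hr hr1)
    have h6 := mul_le_mul_of_nonneg_left h3 (norm_nonneg z)
    have h7 : ‖z‖ * (r * ‖dslope a 0 z - r‖) ≤ ‖z‖ * ‖dslope a 0 z - r‖ := by
      gcongr
      exact mul_le_of_le_one_left (norm_nonneg _) hr1
    nlinarith [mul_le_mul_of_nonneg_right hz.le h5]
  have h8 : a z - z = z * (dslope a 0 z - r - ((1 - r : ℝ) : ℂ)) := by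
    rw [haz]; push_cast; ring
  rw [h8, norm_mul]
  calc ‖z‖ * ‖dslope a 0 z - r - ((1 - r : ℝ) : ℂ)‖
      ≤ 1 * (‖dslope a 0 z - r‖ + ‖((1 - r : ℝ) : ℂ)‖) := by
        gcongr
        exact norm_sub_le _ _
    _ ≤ _ := by
        rw [Complex.norm_real, Real.norm_of_nonneg (by linarith)]
        linarith

/-- A holomorphic self-map of the disc that fixes `0` and whose derivative there is close to `1`
is close to the identity on smaller discs. -/
theorem exists_norm_sub_self_le {R η : ℝ} (hR : R < 1) (hη : 0 < η) :
    ∃ δ ∈ Ioo (0 : ℝ) 1, ∀ (a : ℂ → ℂ) (r : ℝ), DifferentiableOn ℂ a (ball 0 1) →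
      MapsTo a (ball 0 1) (ball 0 1) → a 0 = 0 → deriv a 0 = r → δ < r →
      ∀ z, ‖z‖ ≤ R → ‖a z - z‖ ≤ η := by
  have hc : ContinuousAt (fun r : ℝ ↦ (1 - r) + (1 - r ^ 2) / (1 - R)) 1 := by fun_prop
  have h : ∀ᶠ r : ℝ in 𝓝 1, (1 - r) + (1 - r ^ 2) / (1 - R) < η :=
    hc.eventually_lt continuousAt_const (by simpa using hη)
  obtain ⟨δ, hδ, hδ'⟩ := Metric.eventually_nhds_iff.1 h
  refine ⟨max (1 - δ) (1 / 2), ⟨lt_max_of_lt_right (by norm_num), max_lt (by linarith)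
    (by norm_num)⟩, fun a r ha hm h0 hd hr z hz ↦ ?_⟩
  obtain ⟨hr1, hr2⟩ := max_lt_iff.1 hr
  obtain ⟨hr3, h1⟩ := norm_sub_self_le_of_mapsTo_ball ha hm h0 (by linarith) hd (z := z)
    (by linarith)
  have h2 := hδ' (y := r) (by rw [Real.dist_eq, abs_lt]; constructor <;> linarith)
  refine h1.trans (le_trans ?_ h2.le)
  have h3 : 0 ≤ 1 - r ^ 2 := by nlinarith
  have h4 : 0 < 1 - R := by linarith
  gcongr

/-! ### Stability of a transversal intersection. -/

/-- Cauchy's estimate on discs of radius `ε`: a sup bound becomes a Lipschitz bound on a smaller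
disc. -/
theorem norm_sub_le_of_norm_le {e : ℂ → ℂ} {c : ℂ} {ε M : ℝ} (hε : 0 < ε)
    (he : DifferentiableOn ℂ e (ball c (3 * ε))) (hM : ∀ z ∈ closedBall c (2 * ε), ‖e z‖ ≤ M)
    {x y : ℂ} (hx : x ∈ closedBall c ε) (hy : y ∈ closedBall c ε) :
    ‖e x - e y‖ ≤ M / ε * ‖x - y‖ := by
  refine (convex_closedBall c ε).norm_image_sub_le_of_norm_deriv_le (𝕜 := ℂ) (fun w hw ↦ ?_)
    (fun w hw ↦ ?_) hy hx
  · exact he.differentiableAt (isOpen_ball.mem_nhds (closedBall_subset_ball (by linarith) hw))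
  · have h1 : closedBall w ε ⊆ closedBall c (2 * ε) :=
      closedBall_subset_closedBall' (by rw [mem_closedBall] at hw; linarith)
    refine Complex.norm_deriv_le_of_forall_mem_sphere_norm_le hε ?_
      fun z hz ↦ hM z (h1 (sphere_subset_closedBall hz))
    exact (he.mono (h1.trans (closedBall_subset_ball (by linarith)))).diffContOnCl_ball Subset.rfl

/-- The linear isomorphism `(z, w) ↦ (w - α z, w - β z)`. -/
noncomputable def subMulEquiv {α β : ℂ} (h : α ≠ β) : (ℂ × ℂ) ≃L[ℂ] (ℂ × ℂ) :=
  .equivOfInverse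
    ((ContinuousLinearMap.snd ℂ ℂ ℂ - α • ContinuousLinearMap.fst ℂ ℂ ℂ).prod
      (ContinuousLinearMap.snd ℂ ℂ ℂ - β • ContinuousLinearMap.fst ℂ ℂ ℂ))
    (((β - α)⁻¹ • (ContinuousLinearMap.fst ℂ ℂ ℂ - ContinuousLinearMap.snd ℂ ℂ ℂ)).prod
      (ContinuousLinearMap.fst ℂ ℂ ℂ +
        (α * (β - α)⁻¹) • (ContinuousLinearMap.fst ℂ ℂ ℂ - ContinuousLinearMap.snd ℂ ℂ ℂ)))
    (fun p ↦ by
      have := sub_ne_zero.2 h.symm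
      (ext <;> simp <;> field_simp); ring)
    (fun p ↦ by
      have := sub_ne_zero.2 h.symm
      ext <;> simp <;> field_simp <;> ring)

/-- The map `(z, w) ↦ (w - T₁ z, w - T₂ z)` vanishes at `(0, s)` with invertible derivative `L`.
Inserting `a₁`, `a₂` adds an error small in sup norm, hence in Lipschitz norm, so the quantitative
inverse function theorem still yields a zero. -/
theorem exists_solution_of_near_id {T₁ T₂ : ℂ → ℂ} {s : ℂ}
    (hT₁ : DifferentiableOn ℂ T₁ (ball 0 1)) (hT₂ : DifferentiableOn ℂ T₂ (ball 0 1))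
    (h₁ : T₁ 0 = s) (h₂ : T₂ 0 = s) (hs0 : s ≠ 0) (hs : ‖s‖ < 1)
    (hd : deriv T₁ 0 ≠ deriv T₂ 0) :
    ∃ R < 1, ∃ η > 0, ∀ a₁ a₂ : ℂ → ℂ, DifferentiableOn ℂ a₁ (ball 0 1) →
      DifferentiableOn ℂ a₂ (ball 0 1) → (∀ z, ‖z‖ ≤ R → ‖a₁ z - z‖ ≤ η) →
      (∀ z, ‖z‖ ≤ R → ‖a₂ z - z‖ ≤ η) →
      ∃ z w, z ≠ w ∧ ‖z‖ < 1 ∧ ‖w‖ < 1 ∧ a₁ w = T₁ (a₁ z) ∧ a₂ w = T₂ (a₂ z) := by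
  have hn : ball (0 : ℂ) 1 ∈ 𝓝 (0 : ℂ) := isOpen_ball.mem_nhds (by simp)
  have hs₁ := (hT₁.analyticAt hn).hasStrictDerivAt
  have hs₂ := (hT₂.analyticAt hn).hasStrictDerivAt
  set L := subMulEquiv hd
  have hF : HasStrictFDerivAt (fun p : ℂ × ℂ ↦ (p.2 - T₁ p.1, p.2 - T₂ p.1))
      (L : ℂ × ℂ →L[ℂ] ℂ × ℂ) (0, s) := by
    have hA := hasStrictFDerivAt_snd (𝕜 := ℂ) (p := ((0 : ℂ), s))
    have hB := hasStrictFDerivAt_fst (𝕜 := ℂ) (p := ((0 : ℂ), s))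
    exact (hA.sub (hs₁.comp_hasStrictFDerivAt (0, s) hB)).prodMk
      (hA.sub (hs₂.comp_hasStrictFDerivAt (0, s) hB))
  set N := ‖(L.symm : ℂ × ℂ →L[ℂ] ℂ × ℂ)‖₊ with hN
  have hN0 : 0 < N := by
    refine pos_iff_ne_zero.2 fun h ↦ ?_
    rw [hN, nnnorm_eq_zero] at h
    have := L.symm.injective (a₁ := (1, 1)) (a₂ := 0)
      (by simpa using congrArg (fun f : ℂ × ℂ →L[ℂ] ℂ × ℂ ↦ f (1, 1)) h)
    simp at this
  obtain ⟨U, hU, hUa⟩ := hF.approximates_deriv_on_nhds (c := N⁻¹ / 4) (Or.inr (by positivity))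
  obtain ⟨K₁, V₁, hV₁, hK₁⟩ := hs₁.hasStrictFDerivAt.exists_lipschitzOnWith
  obtain ⟨K₂, V₂, hV₂, hK₂⟩ := hs₂.hasStrictFDerivAt.exists_lipschitzOnWith
  obtain ⟨K, hK₁', hK₂'⟩ : ∃ K, K₁ ≤ K ∧ K₂ ≤ K := ⟨max K₁ K₂, le_max_left _ _, le_max_right _ _⟩
  replace hK₁ := hK₁.weaken hK₁'
  replace hK₂ := hK₂.weaken hK₂'
  obtain ⟨ε₁, hε₁, hUε⟩ := Metric.mem_nhds_iff.1 hU
  obtain ⟨ε₂, hε₂, hVε⟩ := Metric.mem_nhds_iff.1 (inter_mem hV₁ hV₂)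
  have hs0' : 0 < ‖s‖ := norm_pos_iff.2 hs0
  -- In order: `L` approximates well; the `Tᵢ` are Lipschitz at the perturbed points; `z` and `w`
  -- stay apart; the Cauchy discs around `s`, then around `0`, stay in the unit disc.
  obtain ⟨ε, hε, hεU, hεV, hεs, hεR, hε1⟩ : ∃ ε > 0, ε < ε₁ ∧ 4 * ε < ε₂ ∧ 2 * ε < ‖s‖ ∧
      ‖s‖ + 4 * ε < 1 ∧ 4 * ε < 1 := by
    refine ⟨min (min (ε₁ / 2) (ε₂ / 8)) (min (‖s‖ / 4) ((1 - ‖s‖) / 8)), ?_, ?_⟩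
    · have : 0 < 1 - ‖s‖ := by linarith
      positivity
    · have a1 := min_le_left (min (ε₁ / 2) (ε₂ / 8)) (min (‖s‖ / 4) ((1 - ‖s‖) / 8))
      have a2 := min_le_right (min (ε₁ / 2) (ε₂ / 8)) (min (‖s‖ / 4) ((1 - ‖s‖) / 8))
      have a3 := min_le_left (ε₁ / 2) (ε₂ / 8)
      have a4 := min_le_right (ε₁ / 2) (ε₂ / 8)
      have a5 := min_le_left (‖s‖ / 4) ((1 - ‖s‖) / 8)
      have a6 := min_le_right (‖s‖ / 4) ((1 - ‖s‖) / 8)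
      refine ⟨?_, ?_, ?_, ?_, ?_⟩ <;> linarith
  have hK0 : (0 : ℝ) < 1 + K := by positivity
  obtain ⟨η, hη, hηε, hηN⟩ : ∃ η > 0, η ≤ ε ∧ (1 + K) * η ≤ (N : ℝ)⁻¹ / 4 * ε := by
    refine ⟨min ε ((N : ℝ)⁻¹ / 4 * ε / (1 + K)), by positivity, min_le_left _ _, ?_⟩
    rw [← le_div_iff₀' hK0]
    exact min_le_right _ _
  refine ⟨‖s‖ + 3 * ε, by linarith, η, hη, fun a₁ a₂ ha₁ ha₂ hη₁ hη₂ ↦ ?_⟩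
  have aux : ∀ a T : ℂ → ℂ, DifferentiableOn ℂ a (ball 0 1) → DifferentiableOn ℂ T (ball 0 1) →
      (∀ z, ‖z‖ ≤ ‖s‖ + 3 * ε → ‖a z - z‖ ≤ η) → LipschitzOnWith K T (ball 0 ε₂) → T 0 = s →
      ‖a s - T (a 0)‖ ≤ (1 + K) * η ∧
      ∀ p ∈ closedBall ((0 : ℂ), s) ε, ∀ q ∈ closedBall ((0 : ℂ), s) ε,
        ‖(a p.2 - T (a p.1)) - (a q.2 - T (a q.1)) - ((p.2 - T p.1) - (q.2 - T q.1))‖ ≤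
          (N : ℝ)⁻¹ / 4 * ‖p - q‖ := by
    intro a T ha hT haη hTK hT0
    have haT : ∀ z, ‖z‖ ≤ 3 * ε → ‖T (a z) - T z‖ ≤ K * η := fun z hz ↦ by
      have h1 := haη z (by linarith)
      have h2 : ‖a z‖ ≤ ‖a z - z‖ + ‖z‖ := by simpa using norm_add_le (a z - z) z
      refine (hTK.norm_sub_le (by rw [mem_ball_zero_iff]; linarith)
        (by rw [mem_ball_zero_iff]; linarith)).trans ?_
      gcongr
    constructor
    · have h1 := haη s (by linarith)
      have h2 := haT 0 (by simp [hε.le])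
      have h3 : a s - T (a 0) = (a s - s) - (T (a 0) - T 0) := by rw [hT0]; ring
      rw [h3]
      exact (norm_sub_le _ _).trans (by linarith)
    · intro p hp q hq
      rw [← closedBall_prod_same] at hp hq
      have h1 := norm_sub_le_of_norm_le (e := fun z ↦ a z - z) (M := η) hε
        ((ha.mono (ball_subset_ball' (by simp; linarith))).sub differentiableOn_id)
        (fun z hz ↦ haη z (by
          rw [mem_closedBall, dist_eq_norm] at hz
          have : ‖z‖ ≤ ‖z - s‖ + ‖s‖ := by simpa using norm_add_le (z - s) s
          linarith)) hp.2 hq.2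
      have h2 := norm_sub_le_of_norm_le (e := fun z ↦ T (a z) - T z) (c := 0) (M := K * η) hε
        ((hT.comp (ha.mono (ball_subset_ball (by linarith))) (fun z hz ↦ by
            rw [mem_ball_zero_iff] at hz ⊢
            have h1 := haη z (by linarith)
            have h2 : ‖a z‖ ≤ ‖a z - z‖ + ‖z‖ := by simpa using norm_add_le (a z - z) z
            linarith)).sub (hT.mono (ball_subset_ball (by linarith))))
        (fun z hz ↦ haT z (by rw [mem_closedBall_zero_iff] at hz; linarith)) hp.1 hq.1
      have h3 : (a p.2 - T (a p.1)) - (a q.2 - T (a q.1)) - ((p.2 - T p.1) - (q.2 - T q.1)) =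
        ((a p.2 - p.2) - (a q.2 - q.2)) - ((T (a p.1) - T p.1) - (T (a q.1) - T q.1)) := by ring
      rw [h3]
      refine (norm_sub_le _ _).trans ((add_le_add h1 h2).trans ?_)
      have h4 : ‖p.1 - q.1‖ ≤ ‖p - q‖ := norm_fst_le (p - q)
      have h5 : ‖p.2 - q.2‖ ≤ ‖p - q‖ := norm_snd_le (p - q)
      calc η / ε * ‖p.2 - q.2‖ + K * η / ε * ‖p.1 - q.1‖
          ≤ η / ε * ‖p - q‖ + K * η / ε * ‖p - q‖ := by gcongr
        _ = (1 + K) * η / ε * ‖p - q‖ := by ring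
        _ ≤ _ := by
          exact mul_le_mul_of_nonneg_right ((div_le_iff₀ hε).2 hηN) (norm_nonneg _)
  obtain ⟨hb₁, hl₁⟩ := aux a₁ T₁ ha₁ hT₁ hη₁
    (hK₁.mono (((ball_subset_ball le_rfl).trans hVε).trans inter_subset_left)) h₁
  obtain ⟨hb₂, hl₂⟩ := aux a₂ T₂ ha₂ hT₂ hη₂
    (hK₂.mono (((ball_subset_ball le_rfl).trans hVε).trans inter_subset_right)) h₂
  -- The constant is `N⁻¹/4` from the unperturbed map plus `N⁻¹/4` from the error. The image then
  -- covers radius `N⁻¹ε/2` about the value at `(0, s)`, whose norm is at most `N⁻¹ε/4`.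
  have hA : ApproximatesLinearOn (fun p : ℂ × ℂ ↦ (a₁ p.2 - T₁ (a₁ p.1), a₂ p.2 - T₂ (a₂ p.1)))
      (L : ℂ × ℂ →L[ℂ] ℂ × ℂ) (closedBall (0, s) ε) (N⁻¹ / 2) := by
    intro p hp q hq
    have h1 := hUa p (hUε (closedBall_subset_ball hεU hp)) q (hUε (closedBall_subset_ball hεU hq))
    have h2 := max_le (hl₁ p hp q hq) (hl₂ p hp q hq)
    rw [← Prod.norm_mk] at h2
    have h3 := norm_add_le_of_le h1 h2
    refine (le_of_eq ?_).trans (h3.trans (le_of_eq ?_))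
    · congr 1
      ext <;> simp
    · push_cast; ring
  have hsurj := hA.surjOn_closedBall_of_nonlinearRightInverse L.toNonlinearRightInverse hε.le
    Subset.rfl
  obtain ⟨p, hp, hp0⟩ := hsurj (a := 0) (by
    have : (L.toNonlinearRightInverse.nnnorm : ℝ) = N := rfl
    rw [this, mem_closedBall, dist_zero_left, Prod.norm_mk]
    push_cast
    have h0 : 0 < (N : ℝ)⁻¹ * ε := by positivity
    exact max_le (by linarith) (by linarith))
  rw [← closedBall_prod_same] at hp
  have hp1 := mem_closedBall_zero_iff.1 hp.1
  have hp2 := hp.2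
  rw [mem_closedBall, dist_eq_norm] at hp2
  rw [Prod.mk_eq_zero, sub_eq_zero, sub_eq_zero] at hp0
  have h5 : ‖p.2‖ ≤ ‖p.2 - s‖ + ‖s‖ := by simpa using norm_add_le (p.2 - s) s
  refine ⟨p.1, p.2, fun h ↦ ?_, by linarith, by linarith, hp0⟩
  rw [← h] at hp2
  have := norm_sub_norm_le s p.1
  rw [norm_sub_rev] at this
  linarith

/-! ### Calculus on the disc as a manifold. -/

/-- The extension by zero of a self-map of the unit disc, as a function on `ℂ`. -/
noncomputable def discExtend (f : 𝔻 → 𝔻) (z : ℂ) : ℂ :=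
  if h : ‖z‖ < 1 then f (Complex.UnitDisc.mk z h) else 0

@[simp]
theorem discExtend_coe (f : 𝔻 → 𝔻) (z : 𝔻) : discExtend f z = f z := by
  simp [discExtend, z.norm_lt_one]

theorem mapsTo_discExtend (f : 𝔻 → 𝔻) : MapsTo (discExtend f) (ball 0 1) (ball 0 1) := by
  intro z hz
  rw [mem_ball_zero_iff] at hz ⊢
  simpa [discExtend, hz] using (f (.mk z hz)).norm_lt_one

theorem range_unitDisc_coe : range ((↑) : 𝔻 → ℂ) = ball 0 1 := by
  ext z
  rw [mem_ball_zero_iff]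
  exact ⟨fun ⟨w, hw⟩ ↦ hw ▸ w.norm_lt_one, fun h ↦ ⟨.mk z h, rfl⟩⟩

theorem mdifferentiable_unitDisc_coe : MDifferentiable 𝓘(ℂ) 𝓘(ℂ) ((↑) : 𝔻 → ℂ) :=
  (contMDiff_isOpenEmbedding (n := 1) unitDisc_isOpenEmbedding_coe).mdifferentiable one_ne_zero

theorem hasMFDerivAt_unitDisc_coe (z : 𝔻) :
    HasMFDerivAt 𝓘(ℂ) 𝓘(ℂ) ((↑) : 𝔻 → ℂ) z (ContinuousLinearMap.id ℂ ℂ) := by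
  refine ⟨Complex.UnitDisc.continuous_coe.continuousAt, ?_⟩
  have h0 : chartAt ℂ z = unitDisc_isOpenEmbedding_coe.toOpenPartialHomeomorph := rfl
  have h : writtenInExtChartAt 𝓘(ℂ) 𝓘(ℂ) z ((↑) : 𝔻 → ℂ) =ᶠ[𝓝 (z : ℂ)] id := by
    have hz : ball (0 : ℂ) 1 ∈ 𝓝 (z : ℂ) := isOpen_ball.mem_nhds (by simpa using z.norm_lt_one)
    filter_upwards [hz] with w hw
    simp only [writtenInExtChartAt, extChartAt, h0, mfld_simps]
    exact unitDisc_isOpenEmbedding_coe.toOpenPartialHomeomorph_right_inv _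
      (range_unitDisc_coe.symm.subset hw)
  simp only [modelWithCornersSelf_coe, range_id]
  exact ((hasFDerivAt_id (𝕜 := ℂ) (z : ℂ)).congr_of_eventuallyEq h).hasFDerivWithinAt

theorem mdifferentiable_mk_comp {f : 𝔻 → 𝔻}
    (hf : MDifferentiable 𝓘(ℂ) 𝓘(ℂ) (fun z ↦ (f z : ℂ))) : MDifferentiable 𝓘(ℂ) 𝓘(ℂ) f := by
  have h := (contMDiffOn_isOpenEmbedding_symm (n := 1)
    unitDisc_isOpenEmbedding_coe (I := 𝓘(ℂ))).mdifferentiableOn one_ne_zero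
  have h2 : f = unitDisc_isOpenEmbedding_coe.toOpenPartialHomeomorph.symm ∘ (fun z ↦ (f z : ℂ)) := by
    ext z
    exact congrArg _ (unitDisc_isOpenEmbedding_coe.toOpenPartialHomeomorph_left_inv (x := f z)).symm
  rw [h2, ← mdifferentiableOn_univ]
  exact h.comp hf.mdifferentiableOn fun z _ ↦ ⟨f z, rfl⟩

/-- Gives access to one-variable function theory; the values off the open disc play no role. -/
theorem mdifferentiable_iff_differentiableOn_discExtend {f : 𝔻 → 𝔻} :
    MDifferentiable 𝓘(ℂ) 𝓘(ℂ) f ↔ DifferentiableOn ℂ (discExtend f) (ball 0 1) := by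
  constructor
  · intro hf
    have h := (contMDiffOn_isOpenEmbedding_symm (n := 1)
      unitDisc_isOpenEmbedding_coe (I := 𝓘(ℂ))).mdifferentiableOn one_ne_zero
    rw [← mdifferentiableOn_iff_differentiableOn]
    rw [range_unitDisc_coe] at h
    refine ((mdifferentiable_unitDisc_coe.comp hf).comp_mdifferentiableOn h).congr fun z hz ↦ ?_
    rw [← range_unitDisc_coe] at hz
    obtain ⟨w, rfl⟩ := hz
    simp only [discExtend_coe, Function.comp_apply]
    congr 2
    exact (unitDisc_isOpenEmbedding_coe.toOpenPartialHomeomorph_left_inv (x := w)).symm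
  · intro hf
    apply mdifferentiable_mk_comp
    rw [← mdifferentiableOn_iff_differentiableOn] at hf
    have := hf.comp (s := univ) mdifferentiable_unitDisc_coe.mdifferentiableOn
      fun z _ ↦ mem_ball_zero_iff.2 z.norm_lt_one
    rw [mdifferentiableOn_univ] at this
    exact (funext (discExtend_coe f) : discExtend f ∘ ((↑) : 𝔻 → ℂ) = _) ▸ this

theorem mfderiv_disc_apply {f : 𝔻 → 𝔻} (hf : MDifferentiable 𝓘(ℂ) 𝓘(ℂ) f) (z : 𝔻) :
    mfderiv 𝓘(ℂ) 𝓘(ℂ) f z (1 : ℂ) = deriv (discExtend f) z := by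
  have h1 := (hasMFDerivAt_unitDisc_coe (f z)).comp z (hf z).hasMFDerivAt
  have hd : DifferentiableAt ℂ (discExtend f) z :=
    (mdifferentiable_iff_differentiableOn_discExtend.1 hf).differentiableAt
      (isOpen_ball.mem_nhds (by simpa using z.norm_lt_one))
  have h2 := HasMFDerivAt.comp z (hd.hasFDerivAt.hasMFDerivAt) (hasMFDerivAt_unitDisc_coe z)
  have h3 : discExtend f ∘ ((↑) : 𝔻 → ℂ) = (↑) ∘ f := funext fun z ↦ discExtend_coe f z
  rw [h3] at h2
  have h4 := hasMFDerivAt_unique h1 h2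
  exact congrArg (fun L : ℂ →L[ℂ] ℂ ↦ L 1) h4

/-! ### Holomorphic coverings by the disc. -/

instance : SimplyConnectedSpace 𝔻 :=
  have : ContractibleSpace 𝔻 := (convex_ball (0 : ℂ) 1).contractibleSpace ⟨0, by simp⟩
  inferInstance

instance : LocallyPathConnectedSpace 𝔻 :=
  unitDisc_isOpenEmbedding_coe.locallyPathConnectedSpace

/-- A holomorphic map from the disc that is immersive and has the lifting property of a covering
map for holomorphic maps from the disc. -/
structure IsHolomorphicCovering {Y : Type*} [TopologicalSpace Y] [ChartedSpace ℂ Y]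
    (Q : 𝔻 → Y) : Prop where
  mdifferentiable : MDifferentiable 𝓘(ℂ) 𝓘(ℂ) Q
  mfderiv_injective (z : 𝔻) : Function.Injective (mfderiv 𝓘(ℂ) 𝓘(ℂ) Q z)
  exists_lift (g : 𝔻 → Y) (hg : MDifferentiable 𝓘(ℂ) 𝓘(ℂ) g) (z : 𝔻) (hz : g 0 = Q z) :
    ∃ a : 𝔻 → 𝔻, MDifferentiable 𝓘(ℂ) 𝓘(ℂ) a ∧ a 0 = z ∧ Q ∘ a = g

section

variable {Y : Type*} [TopologicalSpace Y] [ChartedSpace ℂ Y]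

theorem IsHolomorphicCovering.comp {Q : 𝔻 → Y} (hQ : IsHolomorphicCovering Q)
    {e : Equiv.Perm 𝔻} (he : e ∈ discAut) : IsHolomorphicCovering (Q ∘ e) where
  mdifferentiable := hQ.mdifferentiable.comp he.1
  mfderiv_injective z := by
    rw [mfderiv_comp z (hQ.mdifferentiable _) (he.1 _)]
    refine (hQ.mfderiv_injective _).comp ?_
    have h : mfderiv 𝓘(ℂ) 𝓘(ℂ) (e.symm ∘ e) z = ContinuousLinearMap.id ℂ _ := by
      rw [e.symm_comp_self]; exact mfderiv_id
    rw [mfderiv_comp z (he.2 _) (he.1 _)] at h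
    exact Function.LeftInverse.injective (fun v ↦ congrArg (fun L ↦ L v) h)
  exists_lift g hg z hz := by
    obtain ⟨a, ha, ha0, hQa⟩ := hQ.exists_lift g hg (e z) hz
    exact ⟨e.symm ∘ a, he.2.comp ha, by simp [ha0], by ext w; simp [← hQa]⟩

theorem eq_id_of_eventually_eq {f : 𝔻 → 𝔻} (hf : MDifferentiable 𝓘(ℂ) 𝓘(ℂ) f) {x : 𝔻}
    (h : ∀ᶠ y in 𝓝 x, f y = y) : f = id := by
  have h1 := (mdifferentiable_iff_differentiableOn_discExtend.1 hf).analyticOnNhd isOpen_ball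
  have h2 : discExtend f =ᶠ[𝓝 (x : ℂ)] id := by
    rw [← unitDisc_isOpenEmbedding_coe.map_nhds_eq]
    exact eventually_map.2 (h.mono fun y hy ↦ by simp [hy])
  have h3 := h1.eqOn_of_preconnected_of_eventuallyEq analyticOnNhd_id
    (convex_ball (0 : ℂ) 1).isPreconnected (mem_ball_zero_iff.2 x.norm_lt_one) h2
  ext z
  simpa using h3 (mem_ball_zero_iff.2 z.norm_lt_one)

/-- If an element of `⟨φ⟩` sends a point of a sheet of `π` into the same sheet, it fixes all nearby
points and is the identity. So `π` is a quotient covering and maps from the simply connected disc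
lift; a lift is locally a holomorphic inverse of `π` composed with `g`. -/
theorem isHolomorphicCovering_of_isLocalDiffeomorph {φ : Equiv.Perm 𝔻} (hφ : φ ∈ discAut)
    {π : 𝔻 → Y} (hπ : Function.Surjective π) (hloc : IsLocalDiffeomorph 𝓘(ℂ) 𝓘(ℂ) ω π)
    (hfib : ∀ z w : 𝔻, π z = π w ↔ z ∈ MulAction.orbit (Subgroup.zpowers φ) w) :
    IsHolomorphicCovering π where
  mdifferentiable := hloc.mdifferentiable (by simp)
  mfderiv_injective z := (hloc.mfderivToContinuousLinearEquiv (by simp) z).injective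
  exists_lift g hg z hz := by
    have hG : ∀ k : Subgroup.zpowers φ, (k : Equiv.Perm 𝔻) ∈ discAut := fun k ↦
      (Subgroup.zpowers_le.2 hφ) k.2
    have hcov : IsQuotientCoveringMap π (Subgroup.zpowers φ) :=
      { (hloc.isOpenMap.isQuotientMap hloc.contMDiff.continuous hπ) with
        continuous_const_smul := fun k ↦ (hG k).1.continuous
        apply_eq_iff_mem_orbit := hfib _ _
        disjoint := fun e ↦ by
          obtain ⟨Ψ, he, hΨ⟩ := hloc.isLocalHomeomorph e
          refine ⟨Ψ.source, Ψ.open_source.mem_nhds he, fun k hk ↦ ?_⟩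
          obtain ⟨_, ⟨x, hx, rfl⟩, hkx⟩ := hk
          have h1 : ∀ᶠ y in 𝓝 x, k.1 y = y := by
            filter_upwards [Ψ.open_source.mem_nhds hx,
              (hG k).1.continuous.continuousAt.preimage_mem_nhds
                (Ψ.open_source.mem_nhds hkx)] with y hy hky
            refine Ψ.injOn hky hy ?_
            rw [← hΨ]
            exact (hfib _ _).2 ⟨k, rfl⟩
          exact Subtype.ext (Equiv.coe_fn_injective (eq_id_of_eventually_eq (hG k).1 h1)) }
    obtain ⟨a, ⟨ha0, ha⟩, -⟩ := hcov.isCoveringMap.existsUnique_continuousMap_lifts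
      ⟨g, hg.continuous⟩ 0 z hz.symm
    refine ⟨a, fun w ↦ ?_, ha0, ha⟩
    have hw := hloc (a w)
    have h2 : (a : 𝔻 → 𝔻) =ᶠ[𝓝 w] hw.localInverse ∘ g := by
      filter_upwards [a.continuous.continuousAt.preimage_mem_nhds
        (hw.localInverse.open_target.mem_nhds hw.localInverse_mem_target)] with y hy
      have h3 : g y = π (a y) := (congrFun ha y).symm
      simp only [Function.comp_apply, h3]
      exact (hw.localInverse_eqOn_left hy).symm
    have h4 : g w = π (a w) := (congrFun ha w).symm
    refine MDifferentiableAt.congr_of_eventuallyEq (MDifferentiableAt.comp w ?_ (hg w)) h2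
    rw [h4]
    exact hw.localInverse_mdifferentiableAt (by simp)

end

/-! ### Disc automorphisms and the pseudo-hyperbolic distance. -/

namespace Complex.UnitDisc

theorem one_add_conj_mul_ne_zero (x z : 𝔻) : (1 + conj (x : ℂ) * z : ℂ) ≠ 0 := fun h ↦ by
  have h1 : ‖conj (x : ℂ) * z‖ = 1 := by rw [← neg_eq_of_add_eq_zero_right h]; simp
  rw [norm_mul, RCLike.norm_conj] at h1
  nlinarith [x.norm_lt_one, z.norm_lt_one, norm_nonneg (x : ℂ), norm_nonneg (z : ℂ)]

theorem norm_mobius_lt_one (x z : 𝔻) : ‖((z : ℂ) + x) / (1 + conj (x : ℂ) * z)‖ < 1 := by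
  rw [norm_div, div_lt_one (norm_pos_iff.2 (one_add_conj_mul_ne_zero x z)),
    ← sq_lt_sq₀ (norm_nonneg _) (norm_nonneg _), Complex.sq_norm, Complex.sq_norm]
  have h1 := x.normSq_lt_one
  have h2 := z.normSq_lt_one
  simp only [Complex.normSq_apply, Complex.add_re, Complex.add_im, Complex.one_re, Complex.one_im,
    Complex.mul_re, Complex.mul_im, Complex.conj_re, Complex.conj_im] at h1 h2 ⊢
  nlinarith [mul_pos (sub_pos.2 h1) (sub_pos.2 h2)]

/-- The disc automorphism `z ↦ (z + x) / (1 + conj x * z)`. -/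
noncomputable def mobius (x : 𝔻) : Equiv.Perm 𝔻 where
  toFun z := mk _ (norm_mobius_lt_one x z)
  invFun z := mk _ (norm_mobius_lt_one (-x) z)
  left_inv z := by
    have h1 := div_mul_cancel₀ ((z : ℂ) + x) (one_add_conj_mul_ne_zero x z)
    have h2 := one_add_conj_mul_ne_zero (-x) (mk _ (norm_mobius_lt_one x z))
    ext
    simp only [coe_mk, coe_neg, map_neg] at h1 h2 ⊢
    rw [div_eq_iff h2]
    linear_combination h1
  right_inv z := by
    have h1 := div_mul_cancel₀ ((z : ℂ) + (-x : 𝔻)) (one_add_conj_mul_ne_zero (-x) z)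
    have h2 := one_add_conj_mul_ne_zero x (mk _ (norm_mobius_lt_one (-x) z))
    ext
    simp only [coe_mk, coe_neg, map_neg] at h1 h2 ⊢
    rw [div_eq_iff h2]
    linear_combination h1

theorem coe_mobius (x z : 𝔻) : (mobius x z : ℂ) = (z + x) / (1 + conj (x : ℂ) * z) := rfl

theorem mobius_mobius_neg (x z : 𝔻) : mobius x (mobius (-x) z) = z := (mobius x).apply_symm_apply z

@[simp]
theorem mobius_zero_right (x : 𝔻) : mobius x 0 = x := by ext; simp [coe_mobius]

theorem mobius_neg_self (x : 𝔻) : mobius (-x) x = 0 := by ext; simp [coe_mobius]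

theorem mobius_mem_discAut (x : 𝔻) : mobius x ∈ discAut := by
  have key : ∀ x : 𝔻, MDifferentiable 𝓘(ℂ) 𝓘(ℂ) (mobius x) := fun x ↦ by
    rw [mdifferentiable_iff_differentiableOn_discExtend]
    have h : DifferentiableOn ℂ (fun z : ℂ ↦ (z + x) / (1 + conj (x : ℂ) * z)) (ball 0 1) :=
      (differentiableOn_id.add_const _).div
        ((differentiableOn_id.const_mul _).const_add _) fun z hz ↦
          one_add_conj_mul_ne_zero x (mk z (mem_ball_zero_iff.1 hz))
    refine h.congr fun z hz ↦ ?_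
    simp [discExtend, mem_ball_zero_iff.1 hz, coe_mobius]
  exact ⟨key x, key (-x)⟩

theorem circleSMul_mem_discAut (u : Circle) : (MulAction.toPerm u : Equiv.Perm 𝔻) ∈ discAut := by
  have key : ∀ u : Circle, MDifferentiable 𝓘(ℂ) 𝓘(ℂ) (fun z : 𝔻 ↦ u • z) := fun u ↦ by
    rw [mdifferentiable_iff_differentiableOn_discExtend]
    refine (differentiableOn_id.const_mul (u : ℂ)).congr fun z hz ↦ ?_
    simp [discExtend, mem_ball_zero_iff.1 hz]
  exact ⟨key u, key u⁻¹⟩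

/-- A disc automorphism that fixes the centre is a rotation. -/
theorem exists_circle_smul_of_mem_discAut {f : Equiv.Perm 𝔻} (hf : f ∈ discAut) (h0 : f 0 = 0) :
    ∃ u : Circle, ∀ z, f z = u • z := by
  have hle : ∀ f : Equiv.Perm 𝔻, MDifferentiable 𝓘(ℂ) 𝓘(ℂ) f → f 0 = 0 →
      ∀ z, ‖(f z : ℂ)‖ ≤ ‖(z : ℂ)‖ := fun f hf h0 z ↦ by
    have := Complex.norm_le_norm_of_mapsTo_ball
      (mdifferentiable_iff_differentiableOn_discExtend.1 hf)
      ((mapsTo_discExtend f).mono_right ball_subset_closedBall)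
      (by simpa [h0] using discExtend_coe f 0) z.norm_lt_one
    simpa using this
  have hnorm : ∀ z, ‖(f z : ℂ)‖ = ‖(z : ℂ)‖ := fun z ↦ by
    refine (hle f hf.1 h0 z).antisymm ?_
    simpa using hle f.symm hf.2 (by rw [Equiv.symm_apply_eq, h0]) (f z)
  have hE0 : discExtend f 0 = 0 := by simpa [h0] using discExtend_coe f 0
  -- Any nonzero point would do: `f` preserves the modulus, so equality holds in Schwarz there.
  set z₀ : 𝔻 := mk (1 / 2) (by norm_num)
  have hz₀ : ‖dslope (discExtend f) 0 z₀‖ = 1 := by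
    have h1 : (z₀ : ℂ) ≠ 0 := by simp [z₀]
    rw [dslope_of_ne _ h1, slope_def_field, hE0, discExtend_coe, sub_zero, sub_zero, norm_div, hnorm,
      div_self (norm_ne_zero_iff.2 h1)]
  have h := Complex.affine_of_mapsTo_ball_of_norm_dslope_eq_div (R₂ := 1)
    (mdifferentiable_iff_differentiableOn_discExtend.1 hf.1)
    (by rw [hE0]; exact (mapsTo_discExtend f).mono_right ball_subset_closedBall)
    (mem_ball_zero_iff.2 z₀.norm_lt_one) (by simpa using hz₀)
  refine ⟨⟨_, mem_sphere_zero_iff_norm.2 hz₀⟩, fun z ↦ ?_⟩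
  ext
  have := h (mem_ball_zero_iff.2 z.norm_lt_one)
  simp only [discExtend_coe, hE0, zero_add, sub_zero, smul_eq_mul] at this
  rw [this, mul_comm]
  rfl

theorem exists_eq_mobius_circle_smul {f : Equiv.Perm 𝔻} (hf : f ∈ discAut) :
    ∃ u : Circle, ∀ z, f z = mobius (f 0) (u • z) := by
  obtain ⟨u, hu⟩ := exists_circle_smul_of_mem_discAut
    (discAut.mul_mem (mobius_mem_discAut (-f 0)) hf) (mobius_neg_self (f 0))
  exact ⟨u, fun z ↦ by rw [← hu, Equiv.Perm.mul_apply, mobius_mobius_neg]⟩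

/-- The pseudo-hyperbolic distance. -/
noncomputable def pdist (z w : 𝔻) : ℝ := ‖(mobius (-z) w : ℂ)‖

theorem pdist_eq (z w : 𝔻) : pdist z w = ‖(w - z : ℂ)‖ / ‖(1 - conj (z : ℂ) * w : ℂ)‖ := by
  rw [pdist, coe_mobius, norm_div, coe_neg, map_neg, neg_mul, ← sub_eq_add_neg, ← sub_eq_add_neg]

theorem pdist_mobius (x z w : 𝔻) : pdist (mobius x z) (mobius x w) = pdist z w := by
  have hA := one_add_conj_mul_ne_zero x z
  have hB := one_add_conj_mul_ne_zero x w
  have ha : (mobius x z : ℂ) * (1 + conj (x : ℂ) * z) = z + x := div_mul_cancel₀ _ hA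
  have hb : (mobius x w : ℂ) * (1 + conj (x : ℂ) * w) = w + x := div_mul_cancel₀ _ hB
  have ha' : conj (mobius x z : ℂ) * (1 + x * conj (z : ℂ)) = conj (z : ℂ) + conj (x : ℂ) := by
    simpa using congrArg conj ha
  have hk : (1 - conj (x : ℂ) * x : ℂ) ≠ 0 := by
    simpa [sub_eq_add_neg] using one_add_conj_mul_ne_zero (-x) x
  have h1 := congrArg norm (show (mobius x w - mobius x z : ℂ) * ((1 + conj (x : ℂ) * z) *
      (1 + conj (x : ℂ) * w)) = (1 - conj (x : ℂ) * x) * (w - z) by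
    linear_combination (1 + conj (x : ℂ) * z) * hb - (1 + conj (x : ℂ) * w) * ha)
  have h2 := congrArg norm (show (1 - conj (mobius x z : ℂ) * mobius x w : ℂ) *
      ((1 + x * conj (z : ℂ)) * (1 + conj (x : ℂ) * w)) =
      (1 - conj (x : ℂ) * x) * (1 - conj (z : ℂ) * w) by
    linear_combination (-(mobius x w : ℂ) * (1 + conj (x : ℂ) * w)) * ha' -
      (conj (z : ℂ) + conj (x : ℂ)) * hb)
  have hn : ‖(1 + x * conj (z : ℂ) : ℂ)‖ = ‖(1 + conj (x : ℂ) * z : ℂ)‖ := by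
    rw [← RCLike.norm_conj]; simp
  have h3 : ∀ z w : 𝔻, ‖(1 - conj (z : ℂ) * w : ℂ)‖ ≠ 0 := fun z w ↦ by
    simpa [sub_eq_add_neg] using one_add_conj_mul_ne_zero (-z) w
  rw [norm_mul, norm_mul, norm_mul] at h1 h2
  rw [hn] at h2
  rw [pdist_eq, pdist_eq, div_eq_div_iff (h3 _ _) (h3 _ _)]
  have hAB := mul_ne_zero (norm_ne_zero_iff.2 hA) (norm_ne_zero_iff.2 hB)
  refine mul_left_cancel₀ (mul_ne_zero (norm_ne_zero_iff.2 hk) hAB) ?_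
  linear_combination (‖(1 + conj (x : ℂ) * z : ℂ)‖ * ‖(1 + conj (x : ℂ) * w : ℂ)‖) *
    (‖(mobius x w - mobius x z : ℂ)‖ * (-h2) +
      ‖(1 - conj (mobius x z : ℂ) * mobius x w : ℂ)‖ * h1)

theorem pdist_circle_smul (u : Circle) (z w : 𝔻) : pdist (u • z) (u • w) = pdist z w := by
  have h : conj (u : ℂ) * u = 1 := by
    rw [mul_comm, Complex.mul_conj, Circle.normSq_coe]; simp
  have h1 : (1 - conj (u * z : ℂ) * (u * w) : ℂ) = 1 - conj (z : ℂ) * w := by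
    rw [map_mul]; linear_combination (- conj (z : ℂ) * w) * h
  rw [pdist_eq, pdist_eq, coe_circle_smul, coe_circle_smul, h1, ← mul_sub, norm_mul,
    Circle.norm_coe, one_mul]

/-- For real `s` the map is a translation along the real diameter, and its displacement is least on
that axis. -/
theorem le_pdist_mobius {s : 𝔻} {t : ℝ} (hs : (s : ℂ) = t) (ht : 0 ≤ t) (z : 𝔻) :
    t ≤ pdist z (mobius s z) := by
  have ht1 : t < 1 := by
    have := s.norm_lt_one
    rwa [hs, Complex.norm_real, Real.norm_of_nonneg ht] at this
  have hD := one_add_conj_mul_ne_zero s z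
  have hm : (mobius s z : ℂ) * (1 + conj (s : ℂ) * z) = z + s := div_mul_cancel₀ _ hD
  rw [hs, Complex.conj_ofReal] at hD hm
  have h0 : (1 - conj (z : ℂ) * mobius s z : ℂ) ≠ 0 := by
    simpa [sub_eq_add_neg] using one_add_conj_mul_ne_zero (-z) (mobius s z)
  rw [pdist_eq, le_div_iff₀ (norm_pos_iff.2 h0)]
  refine le_of_mul_le_mul_right ?_ (norm_pos_iff.2 hD)
  rw [mul_assoc, ← norm_mul, ← norm_mul]
  have h1 : (mobius s z - z : ℂ) * (1 + t * z) = t * (1 - (z : ℂ) ^ 2) := by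
    linear_combination hm
  have h2 : (1 - conj (z : ℂ) * mobius s z : ℂ) * (1 + t * z) =
      1 + t * z - conj (z : ℂ) * (z + t) := by
    linear_combination (-conj (z : ℂ)) * hm
  rw [h1, h2, norm_mul, Complex.norm_real, Real.norm_of_nonneg ht]
  refine mul_le_mul_of_nonneg_left ?_ ht
  rw [← sq_le_sq₀ (norm_nonneg _) (norm_nonneg _), Complex.sq_norm, Complex.sq_norm, sq]
  simp only [Complex.normSq_apply, Complex.add_re, Complex.add_im, Complex.one_re, Complex.one_im,
    Complex.mul_re, Complex.mul_im, Complex.conj_re, Complex.conj_im, Complex.sub_re,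
    Complex.sub_im, Complex.ofReal_re, Complex.ofReal_im]
  -- The squares differ by `4 (1 - t²) (Im z)²`.
  nlinarith [mul_nonneg (sub_nonneg.2 (pow_le_one₀ ht ht1.le : t ^ 2 ≤ 1)) (sq_nonneg (z : ℂ).im)]

/-- The map `z ↦ mobius s (-z)` is the half-turn about the hyperbolic midpoint of `0` and `s`. -/
theorem exists_mobius_neg_eq {s : 𝔻} {t : ℝ} (hs : (s : ℂ) = t) (ht : 0 ≤ t) :
    ∃ z : 𝔻, mobius s (-z) = z := by
  have ht1 : t < 1 := by
    have := s.norm_lt_one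
    rwa [hs, Complex.norm_real, Real.norm_of_nonneg ht] at this
  set q := √(1 - t ^ 2)
  have hq0 : 0 ≤ q := Real.sqrt_nonneg _
  have hq : q ^ 2 = 1 - t ^ 2 := Real.sq_sqrt (by nlinarith)
  -- The smaller root of `t y² - 2 y + t = 0`, in a form that also covers `t = 0`.
  set y := t / (1 + q)
  have hy : y * (1 + q) = t := div_mul_cancel₀ _ (by positivity)
  have hy0 : 0 ≤ y := by positivity
  have hy1 : y < 1 := by
    rw [div_lt_one (by positivity)]; linarith
  have hy2 : t * y ^ 2 - 2 * y + t = 0 := by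
    have h3 : (t * y ^ 2 - 2 * y + t) * (1 + q) ^ 2 = 0 := by
      linear_combination (t * (y * (1 + q) + t) - 2 * (1 + q)) * hy + t * hq
    exact (mul_eq_zero.1 h3).resolve_right (by positivity)
  refine ⟨mk y (by rwa [Complex.norm_real, Real.norm_of_nonneg hy0]), ?_⟩
  ext
  have h := one_add_conj_mul_ne_zero s (-mk y (by rwa [Complex.norm_real, Real.norm_of_nonneg hy0]))
  rw [coe_mobius, div_eq_iff h]
  simp only [coe_neg, coe_mk, hs, Complex.conj_ofReal]
  have h4 : (t * y ^ 2 - 2 * y + t : ℂ) = 0 := mod_cast hy2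
  linear_combination h4

end Complex.UnitDisc

/-! ### Deck transformations in transversal position separate the metrics. -/

theorem IsHolomorphicCovering.deriv_discExtend_eq {Y : Type*} [TopologicalSpace Y]
    [ChartedSpace ℂ Y] {Q : 𝔻 → Y} (hQ : IsHolomorphicCovering Q) {a : 𝔻 → 𝔻}
    (ha : MDifferentiable 𝓘(ℂ) 𝓘(ℂ) a) (ha0 : a 0 = 0) {D L : ℂ →L[ℂ] ℂ}
    (hD : HasMFDerivAt 𝓘(ℂ) 𝓘(ℂ) (Q ∘ a) 0 D) (hL : HasMFDerivAt 𝓘(ℂ) 𝓘(ℂ) Q 0 L) {r : ℂ}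
    (h : D 1 = r • L 1) : deriv (discExtend a) 0 = r := by
  have hinj : Function.Injective L := by
    rw [← hL.mfderiv]; exact hQ.mfderiv_injective 0
  have h1 : HasMFDerivAt 𝓘(ℂ) 𝓘(ℂ) Q (a 0) L := by rwa [ha0]
  have h2 : D = L.comp (mfderiv 𝓘(ℂ) 𝓘(ℂ) a 0 : ℂ →L[ℂ] ℂ) :=
    hasMFDerivAt_unique hD (h1.comp 0 (ha 0).hasMFDerivAt)
  have h3 : D 1 = L (deriv (discExtend a) 0) :=
    (congrArg (fun L : ℂ →L[ℂ] ℂ ↦ L 1) h2).trans (congrArg L (mfderiv_disc_apply ha 0))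
  rw [h3, ← map_smul] at h
  simpa using hinj h

/-- The disc `(Q₁, Q₂)` identifies `0` with `T₁ 0`, and unequal derivatives make this double point
persist for every nearly extremal competitor. -/
theorem injectiveKobayashiMetric_ne_of_isHolomorphicCovering
    {Y₁ : Type*} [TopologicalSpace Y₁] [ChartedSpace ℂ Y₁]
    {Y₂ : Type*} [TopologicalSpace Y₂] [ChartedSpace ℂ Y₂]
    {Q₁ : 𝔻 → Y₁} {Q₂ : 𝔻 → Y₂} (hQ₁ : IsHolomorphicCovering Q₁) (hQ₂ : IsHolomorphicCovering Q₂)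
    {T₁ T₂ : 𝔻 → 𝔻} (hT₁ : MDifferentiable 𝓘(ℂ) 𝓘(ℂ) T₁) (hT₂ : MDifferentiable 𝓘(ℂ) 𝓘(ℂ) T₂)
    (hQT₁ : ∀ z, Q₁ (T₁ z) = Q₁ z) (hQT₂ : ∀ z, Q₂ (T₂ z) = Q₂ z)
    (h0 : T₁ 0 = T₂ 0) (h0' : T₁ 0 ≠ 0)
    (hd : deriv (discExtend T₁) 0 ≠ deriv (discExtend T₂) 0) :
    injectiveKobayashiMetric (𝓘(ℂ).prod 𝓘(ℂ)) (Y₁ × Y₂) ≠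
      kobayashiMetric (𝓘(ℂ).prod 𝓘(ℂ)) (Y₁ × Y₂) := by
  intro heq
  obtain ⟨R, hR, η, hη, key⟩ := exists_solution_of_near_id
    (mdifferentiable_iff_differentiableOn_discExtend.1 hT₁)
    (mdifferentiable_iff_differentiableOn_discExtend.1 hT₂) (s := T₁ 0)
    (by simpa using discExtend_coe T₁ 0) (by simpa [h0] using discExtend_coe T₂ 0)
    (by simpa using h0') (T₁ 0).norm_lt_one hd
  obtain ⟨δ, ⟨hδ0, hδ1⟩, hδ⟩ := exists_norm_sub_self_le hR hη
  have hf : MDifferentiable 𝓘(ℂ) (𝓘(ℂ).prod 𝓘(ℂ)) (fun z ↦ (Q₁ z, Q₂ z)) :=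
    hQ₁.mdifferentiable.prodMk hQ₂.mdifferentiable
  set p := tangentMap 𝓘(ℂ) (𝓘(ℂ).prod 𝓘(ℂ)) (fun z ↦ (Q₁ z, Q₂ z)) ⟨0, (1 : ℂ)⟩ with hp
  have hK : kobayashiMetric (𝓘(ℂ).prod 𝓘(ℂ)) (Y₁ × Y₂) p ≤ ENNReal.ofReal (1 / 1) :=
    iInf₂_le_of_le (fun z ↦ (Q₁ z, Q₂ z)) 1 <| iInf₂_le_of_le one_pos hf <|
      iInf_le_of_le (by simp; rfl) le_rfl
  rw [← heq] at hK
  have hlt := hK.trans_lt (b := ENNReal.ofReal (1 / 1)) (c := ENNReal.ofReal (1 / δ))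
    ((ENNReal.ofReal_lt_ofReal_iff (by positivity)).2
      (by rw [one_div_one]; exact (one_lt_div hδ0).2 hδ1))
  simp only [injectiveKobayashiMetric, iInf_lt_iff] at hlt
  obtain ⟨g, r, hr, hg, hinj, hgt, hlt⟩ := hlt
  rw [ENNReal.ofReal_lt_ofReal_iff (by positivity), one_div_lt_one_div hr hδ0] at hlt
  have hg0 : g 0 = (Q₁ 0, Q₂ 0) := congrArg (·.proj) hgt
  have hg₁ : MDifferentiable 𝓘(ℂ) 𝓘(ℂ) (fun z ↦ (g z).1) := mdifferentiable_fst.comp hg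
  have hg₂ : MDifferentiable 𝓘(ℂ) 𝓘(ℂ) (fun z ↦ (g z).2) := mdifferentiable_snd.comp hg
  obtain ⟨a₁, ha₁, ha₁0, hQa₁⟩ := hQ₁.exists_lift _ hg₁ 0 (by simp [hg0])
  obtain ⟨a₂, ha₂, ha₂0, hQa₂⟩ := hQ₂.exists_lift _ hg₂ 0 (by simp [hg0])
  have hga : g = fun z ↦ (Q₁ (a₁ z), Q₂ (a₂ z)) := by
    ext z
    · exact (congrFun hQa₁ z).symm
    · exact (congrFun hQa₂ z).symm
  obtain ⟨G, hG⟩ : ∃ G : ℂ →L[ℂ] ℂ × ℂ, HasMFDerivAt 𝓘(ℂ) (𝓘(ℂ).prod 𝓘(ℂ)) g 0 G :=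
    ⟨_, (hg 0).hasMFDerivAt⟩
  obtain ⟨L₁, hL₁⟩ : ∃ L : ℂ →L[ℂ] ℂ, HasMFDerivAt 𝓘(ℂ) 𝓘(ℂ) Q₁ 0 L :=
    ⟨_, (hQ₁.mdifferentiable 0).hasMFDerivAt⟩
  obtain ⟨L₂, hL₂⟩ : ∃ L : ℂ →L[ℂ] ℂ, HasMFDerivAt 𝓘(ℂ) 𝓘(ℂ) Q₂ 0 L :=
    ⟨_, (hQ₂.mdifferentiable 0).hasMFDerivAt⟩
  have hder : G 1 = (r : ℂ) • (L₁.prod L₂) 1 := by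
    rw [hp, tangentMap, tangentMap, hG.mfderiv, (hL₁.prodMk hL₂).mfderiv] at hgt
    exact eq_of_heq (Bundle.TotalSpace.ext_iff.1 hgt).2
  have hG₁ : HasMFDerivAt 𝓘(ℂ) 𝓘(ℂ) (Q₁ ∘ a₁) 0 ((ContinuousLinearMap.fst ℂ ℂ ℂ).comp G) := by
    rw [hQa₁]; exact (hasMFDerivAt_fst (g 0)).comp 0 hG
  have hG₂ : HasMFDerivAt 𝓘(ℂ) 𝓘(ℂ) (Q₂ ∘ a₂) 0 ((ContinuousLinearMap.snd ℂ ℂ ℂ).comp G) := by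
    rw [hQa₂]; exact (hasMFDerivAt_snd (g 0)).comp 0 hG
  have hd₁ := hQ₁.deriv_discExtend_eq ha₁ ha₁0 hG₁ hL₁ (congrArg Prod.fst hder)
  have hd₂ := hQ₂.deriv_discExtend_eq ha₂ ha₂0 hG₂ hL₂ (congrArg Prod.snd hder)
  have ha₁' := mdifferentiable_iff_differentiableOn_discExtend.1 ha₁
  have ha₂' := mdifferentiable_iff_differentiableOn_discExtend.1 ha₂
  obtain ⟨z, w, hzw, hz, hw, h₁, h₂⟩ := key _ _ ha₁' ha₂'
    (hδ _ r ha₁' (mapsTo_discExtend _) (by simpa [ha₁0] using discExtend_coe a₁ 0) hd₁ hlt)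
    (hδ _ r ha₂' (mapsTo_discExtend _) (by simpa [ha₂0] using discExtend_coe a₂ 0) hd₂ hlt)
  lift z to 𝔻 using hz
  lift w to 𝔻 using hw
  simp only [discExtend_coe, Complex.UnitDisc.coe_inj] at h₁ h₂
  refine hzw (congrArg _ (hinj (a₁ := z) (a₂ := w) ?_))
  rw [hga]
  simp only [h₁, h₂, hQT₁, hQT₂]

/-! ### Displacement and normal form of hyperbolic automorphisms. -/

namespace Complex.UnitDisc

theorem continuous_pdist_apply {φ : 𝔻 → 𝔻} (hφ : Continuous φ) :
    Continuous fun z ↦ pdist z (φ z) := by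
  simp only [pdist_eq]
  have h : ∀ z w : 𝔻, ‖(1 - conj (z : ℂ) * w : ℂ)‖ ≠ 0 := fun z w ↦ by
    simpa [sub_eq_add_neg] using one_add_conj_mul_ne_zero (-z) w
  have h1 : Continuous fun z ↦ (φ z : ℂ) := continuous_coe.comp hφ
  have h2 := continuous_coe
  exact Continuous.div (by fun_prop) (by fun_prop) fun z ↦ h z _

/-- The displacement of a hyperbolic automorphism is arbitrarily close to `1` near a boundary point
that is not fixed. -/
theorem exists_lt_pdist_of_isHyperbolicDiscAut {φ : Equiv.Perm 𝔻} (hφ : IsHyperbolicDiscAut φ)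
    {s : ℝ} (hs : s < 1) : ∃ z, s < pdist z (φ z) := by
  obtain ⟨-, Φ, hΦ, hΦφ, p, q, -, -, -, hpq⟩ := hφ
  have hinf : (sphere (0 : ℂ) 1).Infinite := by
    refine (isPreconnected_sphere (by simp) 0 1).infinite_of_nontrivial
      ⟨1, by simp, -1, by simp, by norm_num⟩
  obtain ⟨ζ, hζ, hζ'⟩ := hinf.exists_notMem_finite (Set.toFinite {p, q})
  have hζc : ζ ∈ closedBall (0 : ℂ) 1 := sphere_subset_closedBall hζ
  have hne : Φ ζ ≠ ζ := fun h ↦ hζ' (hpq ▸ ⟨hζc, h⟩)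
  rw [mem_sphere_zero_iff_norm] at hζ
  have hζζ : conj ζ * ζ = 1 := by
    rw [mul_comm, Complex.mul_conj, Complex.normSq_eq_norm_sq, hζ]; simp
  -- On the unit circle numerator and denominator of the displacement have equal modulus, so its
  -- limit at `ζ` is 1.
  have h1 : ‖1 - conj ζ * Φ ζ‖ = ‖Φ ζ - ζ‖ := by
    rw [← hζζ, ← mul_sub, norm_mul, RCLike.norm_conj, hζ, one_mul, norm_sub_rev]
  have h0 : ‖Φ ζ - ζ‖ ≠ 0 := norm_ne_zero_iff.2 (sub_ne_zero.2 hne)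
  have hc : ContinuousWithinAt (fun z ↦ ‖Φ z - z‖ / ‖1 - conj z * Φ z‖) (closedBall 0 1) ζ := by
    have h2 := hΦ ζ hζc
    have h3 : ContinuousWithinAt (fun z : ℂ ↦ conj z) (closedBall 0 1) ζ :=
      Complex.continuous_conj.continuousWithinAt
    exact (h2.sub continuousWithinAt_id).norm.div
      ((continuousWithinAt_const.sub (h3.mul h2)).norm) (by rw [h1]; exact h0)
  have hev := (hc.mono ball_subset_closedBall).eventually_const_lt
    (show s < ‖Φ ζ - ζ‖ / ‖1 - conj ζ * Φ ζ‖ by rw [h1, div_self h0]; exact hs)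
  have : (𝓝[ball (0 : ℂ) 1] ζ).NeBot := by
    rw [← mem_closure_iff_nhdsWithin_neBot, closure_ball _ one_ne_zero]
    exact hζc
  obtain ⟨z, hz, hzb⟩ := (hev.and self_mem_nhdsWithin).exists
  lift z to 𝔻 using mem_ball_zero_iff.1 hzb
  exact ⟨z, by rwa [pdist_eq, ← hΦφ]⟩

theorem apply_ne_of_isHyperbolicDiscAut {φ : Equiv.Perm 𝔻} (hφ : IsHyperbolicDiscAut φ) (z : 𝔻) :
    φ z ≠ z := fun h ↦ by
  obtain ⟨-, Φ, -, hΦφ, p, q, -, hp, hq, hpq⟩ := hφ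
  have hz : (z : ℂ) ∈ ({p, q} : Set ℂ) :=
    hpq ▸ ⟨mem_closedBall_zero_iff.2 z.norm_lt_one.le, by rw [hΦφ, h]⟩
  rcases hz with rfl | rfl
  exacts [z.norm_ne_one hp, z.norm_ne_one hq]

/-- Every displacement between that of the centre and `1` is realized, after a change of
coordinate, as the displacement of the centre, along the positive real axis. -/
theorem exists_conj_eq_mobius_circle_smul {φ : Equiv.Perm 𝔻} (hφ : IsHyperbolicDiscAut φ)
    {s : 𝔻} {t : ℝ} (hs : (s : ℂ) = t) (ht : pdist 0 (φ 0) < t) :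
    ∃ e ∈ discAut, ∃ u : Circle, (u : ℂ) ≠ 1 ∧ (u : ℂ) ≠ -1 ∧
      ∀ z, φ (e z) = e (mobius s (u • z)) := by
  have ht0 : 0 < t := (norm_nonneg _).trans_lt ht
  have ht1 : t < 1 := by
    have := s.norm_lt_one
    rwa [hs, Complex.norm_real, Real.norm_of_nonneg ht0.le] at this
  obtain ⟨z₁, hz₁⟩ := exists_lt_pdist_of_isHyperbolicDiscAut hφ ht1
  obtain ⟨x, hx⟩ := mem_range_of_exists_le_of_exists_ge (continuous_pdist_apply hφ.1.1.continuous)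
    ⟨0, ht.le⟩ ⟨z₁, hz₁.le⟩
  obtain ⟨c, hc⟩ : ∃ c : Circle, c • s = mobius (-x) (φ x) := by
    refine ⟨⟨(mobius (-x) (φ x) : ℂ) / t, ?_⟩, ?_⟩
    · refine mem_sphere_zero_iff_norm.2 ?_
      rw [norm_div, Complex.norm_real, Real.norm_of_nonneg ht0.le]
      exact (div_eq_one_iff_eq ht0.ne').2 hx
    · ext
      refine (coe_circle_smul _ _).trans ?_
      rw [hs]
      exact div_mul_cancel₀ _ (by exact_mod_cast ht0.ne')
  set e : Equiv.Perm 𝔻 := mobius x * MulAction.toPerm c with he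
  have heD : e ∈ discAut := discAut.mul_mem (mobius_mem_discAut x) (circleSMul_mem_discAut c)
  have hez : ∀ z, e z = mobius x (c • z) := fun z ↦ rfl
  have hpe : ∀ z w, pdist (e z) (e w) = pdist z w := fun z w ↦ by
    rw [hez, hez, pdist_mobius, pdist_circle_smul]
  have hs' : (e⁻¹ * φ * e) 0 = s := by
    have h0 : e 0 = x := by
      have : c • (0 : 𝔻) = 0 := by ext; simp
      rw [hez, this, mobius_zero_right]
    rw [Equiv.Perm.mul_apply, Equiv.Perm.mul_apply, h0, Equiv.Perm.inv_eq_iff_eq, hez, hc,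
      mobius_mobius_neg]
  obtain ⟨u, hu⟩ := exists_eq_mobius_circle_smul
    (discAut.mul_mem (discAut.mul_mem (discAut.inv_mem heD) hφ.1) heD)
  rw [hs'] at hu
  have hT : ∀ z, φ (e z) = e (mobius s (u • z)) := fun z ↦ by
    rw [← hu]
    exact (e.apply_symm_apply _).symm
  refine ⟨e, heD, u, fun h ↦ ?_, fun h ↦ ?_, hT⟩
  -- If `u = 1`, the conjugate is a translation with least displacement `t`, but `φ` moves the
  -- centre by less.
  · have h1 := le_pdist_mobius hs ht0.le (e⁻¹ 0)
    have h3 : e (e⁻¹ 0) = 0 := e.apply_symm_apply 0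
    have h2 : u • (e⁻¹ 0) = e⁻¹ 0 := by ext; simp [h]
    rw [← hpe, ← h2, ← hT, h2, h3] at h1
    exact h1.not_gt ht
  -- If `u = -1`, the conjugate is a half-turn and has a fixed point in the disc.
  · obtain ⟨z, hz⟩ := exists_mobius_neg_eq hs ht0.le
    have h2 : u • z = -z := by ext; simp [h]
    refine apply_ne_of_isHyperbolicDiscAut hφ (e z) ?_
    rw [hT, h2, hz]

theorem deriv_discExtend_mobius_circle_smul (s : 𝔻) (u : Circle) :
    deriv (discExtend fun z ↦ mobius s (u • z)) 0 = (1 - conj (s : ℂ) * s) * u := by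
  have h : discExtend (fun z ↦ mobius s (u • z)) =ᶠ[𝓝 0]
      fun z : ℂ ↦ (u * z + s) / (1 + conj (s : ℂ) * (u * z)) := by
    filter_upwards [isOpen_ball.mem_nhds (mem_ball_self (x := (0 : ℂ)) one_pos)] with z hz
    simp [discExtend, mem_ball_zero_iff.1 hz, coe_mobius]
  have h1 : HasDerivAt (fun z : ℂ ↦ (u : ℂ) * z) u 0 := by
    simpa using (hasDerivAt_id (0 : ℂ)).const_mul (u : ℂ)
  have h2 := (h1.add_const (s : ℂ)).div ((h1.const_mul (conj (s : ℂ))).const_add 1) (by simp)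
  rw [h.deriv_eq]
  refine h2.deriv.trans ?_
  simp
  ring

theorem mobius_circle_smul_mdifferentiable (s : 𝔻) (u : Circle) :
    MDifferentiable 𝓘(ℂ) 𝓘(ℂ) fun z ↦ mobius s (u • z) :=
  (mobius_mem_discAut s).1.comp (circleSMul_mem_discAut u).1

end Complex.UnitDisc

/-! ### Matching the two annuli. -/

open Complex.UnitDisc

theorem IsAnnulus.exists_isHolomorphicCovering {Y : Type*} [TopologicalSpace Y] [ChartedSpace ℂ Y]
    (hY : IsAnnulus Y) : ∃ c < 1, ∀ (s : 𝔻) (t : ℝ), (s : ℂ) = t → c < t →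
      ∃ u : Circle, (u : ℂ) ≠ 1 ∧ (u : ℂ) ≠ -1 ∧
        (∃ Q : 𝔻 → Y, IsHolomorphicCovering Q ∧ ∀ z, Q (mobius s (u • z)) = Q z) ∧
        ∃ Q : 𝔻 → Y, IsHolomorphicCovering Q ∧ ∀ z, Q (mobius s (u⁻¹ • z)) = Q z := by
  obtain ⟨φ, hφ, π, hπ, hloc, hfib⟩ := hY
  have hcov := isHolomorphicCovering_of_isLocalDiffeomorph hφ.1 hπ hloc hfib
  have hπφ : ∀ z, π (φ z) = π z := fun z ↦
    (hfib _ _).2 ⟨⟨φ, Subgroup.mem_zpowers φ⟩, rfl⟩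
  refine ⟨pdist 0 (φ 0), norm_lt_one _, fun s t hs ht ↦ ?_⟩
  obtain ⟨e, he, u, hu1, hu2, hT⟩ := exists_conj_eq_mobius_circle_smul hφ hs ht
  have hQ : ∀ z, π (e (mobius s (u • z))) = π (e z) := fun z ↦ by rw [← hT, hπφ]
  refine ⟨u, hu1, hu2, ⟨_, hcov.comp he, hQ⟩, ?_⟩
  have hneg : (Equiv.neg 𝔻 : Equiv.Perm 𝔻) ∈ discAut := by
    have : (Equiv.neg 𝔻 : Equiv.Perm 𝔻) = MulAction.toPerm (-1 : Circle) := by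
      ext z; simp
    rw [this]
    exact circleSMul_mem_discAut _
  -- This half-turn swaps `0` and `s`, and conjugates `z ↦ mobius s (u⁻¹ • z)` to the inverse of `z
  -- ↦ mobius s (u • z)`.
  have hι : mobius s * Equiv.neg 𝔻 ∈ discAut := discAut.mul_mem (mobius_mem_discAut s) hneg
  refine ⟨_, (hcov.comp he).comp hι, fun z ↦ ?_⟩
  have hu : mobius s (u • mobius s (-mobius s (u⁻¹ • z))) = mobius s (-z) := by
    have h1 : -mobius s (u⁻¹ • z) = mobius (-s) (-(u⁻¹ • z)) := by
      ext; simp only [coe_neg, coe_mobius, map_neg]; rw [← neg_div]; congr 1 <;> ring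
    have h2 : u • -(u⁻¹ • z) = -z := by
      ext; simp
    rw [h1, mobius_mobius_neg, h2]
  have := hQ (mobius s (-mobius s (u⁻¹ • z)))
  rw [hu] at this
  exact this.symm

theorem mainTheorem6
    (Y₁ : Type*) [TopologicalSpace Y₁] [ChartedSpace ℂ Y₁] [IsManifold 𝓘(ℂ) ω Y₁]
    (Y₂ : Type*) [TopologicalSpace Y₂] [ChartedSpace ℂ Y₂] [IsManifold 𝓘(ℂ) ω Y₂]
    (h₁ : IsAnnulus Y₁) (h₂ : IsAnnulus Y₂) :
    injectiveKobayashiMetric (𝓘(ℂ).prod 𝓘(ℂ)) (Y₁ × Y₂) ≠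
      kobayashiMetric (𝓘(ℂ).prod 𝓘(ℂ)) (Y₁ × Y₂) := by
  obtain ⟨c₁, hc₁, H₁⟩ := h₁.exists_isHolomorphicCovering
  obtain ⟨c₂, hc₂, H₂⟩ := h₂.exists_isHolomorphicCovering
  -- One displacement attained by both generators, positive so that `s ≠ 0`.
  obtain ⟨t, ht, ht1⟩ := exists_between (max_lt (max_lt hc₁ hc₂) one_pos)
  obtain ⟨ht2, ht0⟩ := max_lt_iff.1 ht
  obtain ⟨htc₁, htc₂⟩ := max_lt_iff.1 ht2
  obtain ⟨s, hs⟩ : ∃ s : 𝔻, (s : ℂ) = t :=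
    ⟨.mk t (by rwa [Complex.norm_real, Real.norm_of_nonneg ht0.le]), rfl⟩
  have hs0 : s ≠ 0 := fun h ↦ by
    rw [h, Complex.UnitDisc.coe_zero] at hs
    exact ht0.ne (by exact_mod_cast hs)
  obtain ⟨u, hu1, hu2, ⟨Q₁, hQ₁, hQu₁⟩, -⟩ := H₁ s t hs htc₁
  obtain ⟨v, -, -, ⟨Q₂, hQ₂, hQv₂⟩, ⟨Q₂', hQ₂', hQv₂'⟩⟩ := H₂ s t hs htc₂
  have main : ∀ w : Circle, w ≠ u → ∀ Q : 𝔻 → Y₂, IsHolomorphicCovering Q →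
      (∀ z, Q (mobius s (w • z)) = Q z) →
      injectiveKobayashiMetric (𝓘(ℂ).prod 𝓘(ℂ)) (Y₁ × Y₂) ≠
        kobayashiMetric (𝓘(ℂ).prod 𝓘(ℂ)) (Y₁ × Y₂) := fun w hw Q hQ hQw ↦ by
    have h0 : ∀ u : Circle, mobius s (u • (0 : 𝔻)) = s := fun u ↦ by
      have : u • (0 : 𝔻) = 0 := by ext; simp
      rw [this, mobius_zero_right]
    refine injectiveKobayashiMetric_ne_of_isHolomorphicCovering hQ₁ hQ
      (mobius_circle_smul_mdifferentiable s u) (mobius_circle_smul_mdifferentiable s w) hQu₁ hQw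
      (by rw [h0, h0]) (by rwa [h0]) fun h ↦ hw ?_
    rw [deriv_discExtend_mobius_circle_smul, deriv_discExtend_mobius_circle_smul] at h
    have h1 : (1 - conj (s : ℂ) * s : ℂ) ≠ 0 := by
      simpa [sub_eq_add_neg] using one_add_conj_mul_ne_zero (-s) s
    exact Circle.ext (mul_left_cancel₀ h1 h).symm
  by_cases h : v = u
  · refine main v⁻¹ (fun h' ↦ ?_) Q₂' hQ₂' hQv₂'
    have h3 : (u : ℂ) * u = 1 := by
      have : u⁻¹ = u := by rwa [h] at h'
      rw [← Circle.coe_mul]; nth_rewrite 1 [← this]; simp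
    rcases mul_self_eq_one_iff.1 h3 with h4 | h4
    exacts [hu1 h4, hu2 h4]
  · exact main v h Q₂ hQ₂ hQv₂
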